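/- Let $A$ and $B$ be (not necessarily unital) $\mathrm{C}^*$-algebras and let $\theta\colon A\to B$ be a completely positive linear map that is order zero, i.e. $\theta(a)\theta(b)=0$ for all positive $a,b\in A$ with $ab=0$. For $r\ge 1$ let $\theta^{(r)}\colon \mathrm{M}_r(A)\to \mathrm{M}_r(B)$ denote the map that applies $\theta$ to each matrix entry. Then $\theta$ is isometric if and only if $\theta$ is a complete order embedding, i.e. if and only if for every $r\ge 1$ the map $\theta^{(r)}$ is isometric and, for every $x\in \mathrm{M}_r(A)$, $x\ge 0$ if and only if $\theta^{(r)}(x)\ge 0$. -/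

import Mathlib

open scoped CStarAlgebra

/-- A completely positive map `θ : A → B` between C⋆-algebras is *order zero* if it preserves
orthogonality of positive elements: `a b = 0` implies `θ(a) θ(b) = 0` for all `a, b ∈ A₊`. -/
def IsOrderZero {A B : Type*} [NonUnitalCStarAlgebra A] [PartialOrder A] [StarOrderedRing A]
    [NonUnitalCStarAlgebra B] [PartialOrder B] [StarOrderedRing B] (θ : A →CP B) : Prop :=
  ∀ a b : A, 0 ≤ a → 0 ≤ b → a * b = 0 → θ a * θ b = 0

/-- A completely positive map `θ : A → B` between C⋆-algebras is a *complete order embedding* if,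
for every `r ≥ 1`, the entrywise amplification `θ⁽ʳ⁾ : M_r(A) → M_r(B)` is isometric (for the
C⋆-norms) and `x ≥ 0` if and only if `θ⁽ʳ⁾(x) ≥ 0`, for all `x ∈ M_r(A)`. -/
structure IsCompleteOrderEmbedding {A B : Type*}
    [NonUnitalCStarAlgebra A] [PartialOrder A] [StarOrderedRing A]
    [NonUnitalCStarAlgebra B] [PartialOrder B] [StarOrderedRing B] (θ : A →CP B) : Prop where
  isometry_map : ∀ r : ℕ, 1 ≤ r →
    Isometry (fun x : CStarMatrix (Fin r) (Fin r) A => x.map θ)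
  nonneg_iff : ∀ r : ℕ, 1 ≤ r → ∀ x : CStarMatrix (Fin r) (Fin r) A, 0 ≤ x ↔ 0 ≤ x.map θ

/-! ### Bilinear maps on `C(K, ℝ)` that vanish on zero products -/

section Diagonal

variable {K E : Type*} [TopologicalSpace K] [NormedAddCommGroup E] [NormedSpace ℝ E]

/-! Everything rests on the balanced identity `θ(xy) θ(z) = θ(x) θ(yz)` (`map_mul_map_eq`).
Positivity of 2 × 2 matrices upgrades order zero to preservation of all zero products; functional
calculus then reduces the identity to a bilinear map on `C(K, ℝ)`. Unlike orthogonality, the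
identity passes entrywise to matrices.

For matrices it does three things. With injectivity it reflects positivity: if `x = s⋆s - m` with
`sm = 0`, then `θ(s⋆s) θ(m) = 0`, so `θ(x) ≥ 0` forces `m = 0`. It gives contractivity by a power
trick that removes the constant from a crude entrywise bound. Finally, if `‖θ(x)‖ < ‖x‖` for some `x
≥ 0`, a spectral piece of `x` near its norm has a nonzero entry `c`; moving powers of `x` across the
identity makes powers of `θ(cc⋆)` decay faster than isometry of `θ` on `A` allows
(`le_norm_amplification_of_nonneg`). -/

theorem Finset.sum_range_three_mul {M : Type*} [AddCommMonoid M] (f : ℕ → M) (n : ℕ) :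
    ∑ k ∈ Finset.range (3 * n), f k =
      ∑ i ∈ Finset.range n, (f (3 * i) + f (3 * i + 1) + f (3 * i + 2)) := by
  induction n with
  | zero => simp
  | succ n ih =>
    rw [Finset.sum_range_succ, ← ih, show 3 * (n + 1) = 3 * n + 1 + 1 + 1 by ring,
      Finset.sum_range_succ, Finset.sum_range_succ, Finset.sum_range_succ]
    simp only [add_assoc]

/-- The unit ramp `min 1 (f + 1 - k)`, truncated below at zero. -/
noncomputable def ContinuousMap.ramp (f : C(K, ℝ)) (k : ℕ) : C(K, ℝ) :=
  ⟨fun t => max 0 (min 1 (f t + 1 - k)), by fun_prop⟩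

theorem ContinuousMap.sum_ramp {f : C(K, ℝ)} (hf : 0 ≤ f) {n : ℕ} (hn : ∀ t, f t ≤ n) :
    ∑ k ∈ Finset.range n, f.ramp (k + 1) = f := by
  ext t
  have h0 : 0 ≤ f t := hf t
  have key : ∀ n : ℕ, (∑ k ∈ Finset.range n, f.ramp (k + 1)) t = min (f t) n := by
    intro n
    induction n with
    | zero => simp [h0]
    | succ n ih =>
      rw [Finset.sum_range_succ, ContinuousMap.add_apply, ih]
      simp only [ContinuousMap.ramp, ContinuousMap.coe_mk]
      push_cast
      rw [show f t + 1 - (n + 1 : ℝ) = f t - n by ring]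
      rcases le_total (f t) n with h | h
      · rw [min_eq_left h, min_eq_left (h.trans (by linarith)), max_eq_left, add_zero]
        exact (min_le_right _ _).trans (by linarith)
      · rw [min_eq_right h, max_eq_right (le_min zero_le_one (by linarith))]
        rcases le_total (f t) (n + 1) with h' | h'
        · rw [min_eq_right (show f t - n ≤ 1 by linarith), min_eq_left h']; ring
        · rw [min_eq_left (show 1 ≤ f t - n by linarith), min_eq_right h']
  rw [key, min_eq_left (hn t)]

variable (ψ : C(K, ℝ) →ₗ[ℝ] C(K, ℝ) →ₗ[ℝ] E)

theorem bilinear_sum_eq_of_cross_eq_zero (h : ∀ f g, f * g = 0 → ψ f g = 0) (n : ℕ)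
    (p q : ℕ → C(K, ℝ)) (hpq : ∀ i j, i ≠ j → p i * q j = 0) :
    ∑ i ∈ Finset.range n, ψ (p i) (q i) =
      ψ (∑ i ∈ Finset.range n, p i) (∑ i ∈ Finset.range n, q i) := by
  rw [map_sum]
  refine Finset.sum_congr rfl fun i hi => ?_
  rw [map_sum, LinearMap.sum_apply, Finset.sum_eq_single i]
  · exact fun j _ hj => h _ _ (hpq j i hj)
  · exact fun hi' => absurd hi hi'

variable [CompactSpace K]

/-- Sparse sums of consecutive differences of a decreasing sequence in `[0, 1]` are at most one. -/
theorem ContinuousMap.norm_sum_sub_succ_le_one {W : ℕ → C(K, ℝ)} (hanti : Antitone W)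
    (h0 : ∀ k, 0 ≤ W k) (h1 : ∀ k, W k ≤ 1) (s n : ℕ) :
    ‖∑ i ∈ Finset.range n, (W (3 * i + s) - W (3 * i + s + 1))‖ ≤ 1 := by
  have key : ∀ n, ∀ t : K,
      0 ≤ (∑ i ∈ Finset.range n, (W (3 * i + s) - W (3 * i + s + 1))) t ∧
      (∑ i ∈ Finset.range n, (W (3 * i + s) - W (3 * i + s + 1))) t ≤ 1 - W (3 * n + s) t := by
    intro n t
    induction n with
    | zero => simpa using h1 s t
    | succ n ih =>
      rw [Finset.sum_range_succ, ContinuousMap.add_apply, ContinuousMap.sub_apply]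
      have a1 : W (3 * n + s + 1) t ≤ W (3 * n + s) t := hanti (by omega) t
      have a2 : W (3 * (n + 1) + s) t ≤ W (3 * n + s + 1) t := hanti (by omega) t
      constructor <;> linarith [ih.1, ih.2]
  rw [ContinuousMap.norm_le _ zero_le_one]
  intro t
  have h : 0 ≤ W (3 * n + s) t := h0 _ t
  rw [Real.norm_eq_abs, abs_le]
  constructor <;> linarith [(key n t).1, (key n t).2]

/-- Each commutator is a difference of values of `ψ` at adjacent bumps `W k - W (k + 1)`. A stride
of three makes distinct pairs orthogonal, so each sum collapses to one value of `ψ` at functions of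
norm at most one, whatever `n` is. -/
theorem norm_sum_commutator_le {C : ℝ} (hC0 : 0 ≤ C) (hC : ∀ f g, ‖ψ f g‖ ≤ C * ‖f‖ * ‖g‖)
    (h : ∀ f g, f * g = 0 → ψ f g = 0) {W : ℕ → C(K, ℝ)} (hanti : Antitone W)
    (h0 : ∀ k, 0 ≤ W k) (h1 : ∀ k, W k ≤ 1) (hW : ∀ i j, j < i → W i * (1 - W j) = 0) (s n : ℕ) :
    ‖∑ i ∈ Finset.range n, (ψ (W (3 * i + s + 1)) 1 - ψ 1 (W (3 * i + s + 1)))‖ ≤ 2 * C := by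
  have hW' : ∀ i j, j < i → W i * W j = W i := fun i j hij => by
    have := hW i j hij
    rw [mul_sub, mul_one, sub_eq_zero] at this
    exact this.symm
  have key : ∀ k, ψ (W (k + 1)) 1 - ψ 1 (W (k + 1)) =
      ψ (W (k + 1) - W (k + 2)) (W k - W (k + 1)) -
        ψ (W k - W (k + 1)) (W (k + 1) - W (k + 2)) := by
    intro k
    have e1 : ψ (W (k + 2)) (1 - W (k + 1)) = 0 := h _ _ (hW _ _ (by omega))
    have e2 : ψ (W (k + 1) - W (k + 2)) (1 - W k) = 0 := h _ _ (by
      rw [sub_mul, hW _ _ (by omega), hW _ _ (by omega), sub_zero])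
    have e3 : ψ (1 - W (k + 1)) (W (k + 2)) = 0 := h _ _ (by
      rw [mul_comm]; exact hW _ _ (by omega))
    have e4 : ψ (1 - W k) (W (k + 1) - W (k + 2)) = 0 := h _ _ (by
      rw [mul_comm, sub_mul, hW _ _ (by omega), hW _ _ (by omega), sub_zero])
    simp only [map_sub, LinearMap.sub_apply] at e1 e2 e3 e4 ⊢
    linear_combination (norm := module) e1 + e2 - e3 - e4
  have cross : ∀ i j, i ≠ j → (W (3 * i + s + 1) - W (3 * i + s + 2)) *
      (W (3 * j + s) - W (3 * j + s + 1)) = 0 := by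
    intro i j hij
    rcases lt_or_gt_of_ne hij with hlt | hlt
    · rw [mul_comm, sub_mul, mul_sub, mul_sub, hW' _ _ (by omega), hW' _ _ (by omega),
        hW' _ _ (by omega), hW' _ _ (by omega)]
      simp
    · rw [sub_mul, mul_sub, mul_sub, hW' _ _ (by omega), hW' _ _ (by omega),
        hW' _ _ (by omega), hW' _ _ (by omega)]
      simp
  have cross' : ∀ i j, i ≠ j → (W (3 * i + s) - W (3 * i + s + 1)) *
      (W (3 * j + s + 1) - W (3 * j + s + 2)) = 0 := fun i j hij => by
    rw [mul_comm]; exact cross j i hij.symm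
  simp_rw [key]
  rw [Finset.sum_sub_distrib,
    bilinear_sum_eq_of_cross_eq_zero ψ h n (fun i => W (3 * i + s + 1) - W (3 * i + s + 2))
      (fun i => W (3 * i + s) - W (3 * i + s + 1)) cross,
    bilinear_sum_eq_of_cross_eq_zero ψ h n (fun i => W (3 * i + s) - W (3 * i + s + 1))
      (fun i => W (3 * i + s + 1) - W (3 * i + s + 2)) cross']
  have b1 := ContinuousMap.norm_sum_sub_succ_le_one hanti h0 h1 s n
  have b2 := ContinuousMap.norm_sum_sub_succ_le_one hanti h0 h1 (s + 1) n
  simp only [← add_assoc] at b2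
  have bd : ∀ f g : C(K, ℝ), ‖f‖ ≤ 1 → ‖g‖ ≤ 1 → ‖ψ f g‖ ≤ C := fun f g hf hg =>
    (hC f g).trans (by
      calc C * ‖f‖ * ‖g‖ ≤ C * 1 * 1 := by gcongr
        _ = C := by ring)
  refine (norm_sub_le _ _).trans ?_
  rw [two_mul]
  exact add_le_add (bd _ _ b2 b1) (bd _ _ b1 b2)

/-- The bound does not depend on `f`, so rescaling `f` will force the commutator to vanish. The 6 is
`2 * C` for each residue mod 3. -/
theorem norm_commutator_le {C : ℝ} (hC0 : 0 ≤ C) (hC : ∀ f g, ‖ψ f g‖ ≤ C * ‖f‖ * ‖g‖)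
    (h : ∀ f g, f * g = 0 → ψ f g = 0) {f : C(K, ℝ)} (hf : 0 ≤ f) :
    ‖ψ f 1 - ψ 1 f‖ ≤ 6 * C := by
  obtain ⟨n, hn⟩ := exists_nat_ge ‖f‖
  have hfn : ∀ t, f t ≤ (3 * n : ℕ) := fun t => by
    have := (le_abs_self _).trans (f.norm_coe_le_norm t)
    push_cast
    linarith [norm_nonneg f]
  have hanti : Antitone f.ramp := fun i j hij t => by
    have : (i : ℝ) ≤ j := by exact_mod_cast hij
    exact max_le_max le_rfl (min_le_min le_rfl (by linarith))
  have h0 : ∀ k, 0 ≤ f.ramp k := fun k t => le_max_left _ _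
  have h1 : ∀ k, f.ramp k ≤ 1 := fun k t => max_le zero_le_one (min_le_left _ _)
  have hW : ∀ i j, j < i → f.ramp i * (1 - f.ramp j) = 0 := fun i j hij => by
    ext t
    have hij' : (j : ℝ) + 1 ≤ i := by exact_mod_cast hij
    simp only [ContinuousMap.ramp, ContinuousMap.mul_apply, ContinuousMap.sub_apply,
      ContinuousMap.coe_mk, ContinuousMap.one_apply, ContinuousMap.zero_apply, mul_eq_zero]
    rcases le_total (f t + 1 - i) 0 with h | h
    · exact Or.inl (max_eq_left ((min_le_right _ _).trans h))
    · right
      rw [min_eq_left (by linarith), max_eq_right zero_le_one, sub_self]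
  have e : ψ f 1 - ψ 1 f =
      ∑ k ∈ Finset.range (3 * n), (ψ (f.ramp (k + 1)) 1 - ψ 1 (f.ramp (k + 1))) := by
    conv_lhs => rw [← ContinuousMap.sum_ramp hf hfn]
    rw [Finset.sum_sub_distrib, map_sum, map_sum, LinearMap.sum_apply]
  rw [e, Finset.sum_range_three_mul, Finset.sum_add_distrib, Finset.sum_add_distrib]
  have b := fun s => norm_sum_commutator_le ψ hC0 hC h hanti h0 h1 hW s n
  refine norm_add₃_le.trans ?_
  linarith [b 0, b 1, b 2]

/-- A bounded bilinear map on `C(K, ℝ)` that vanishes on pairs with zero product is balanced. -/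
theorem bilinear_apply_one_eq {C : ℝ} (hC0 : 0 ≤ C) (hC : ∀ f g, ‖ψ f g‖ ≤ C * ‖f‖ * ‖g‖)
    (h : ∀ f g, f * g = 0 → ψ f g = 0) {f : C(K, ℝ)} (hf : 0 ≤ f) : ψ f 1 = ψ 1 f := by
  rw [← sub_eq_zero, ← norm_le_zero_iff]
  by_contra! hpos
  obtain ⟨n, hn⟩ := exists_nat_gt (6 * C / ‖ψ f 1 - ψ 1 f‖)
  rw [div_lt_iff₀ hpos] at hn
  have := norm_commutator_le ψ hC0 hC h (f := (n : ℝ) • f) (fun t => mul_nonneg n.cast_nonneg (hf t))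
  rw [map_smul, map_smul, LinearMap.smul_apply, ← smul_sub, norm_smul, Real.norm_natCast] at this
  linarith

end Diagonal

/-! ### Preservation of zero products -/

open Filter Topology in
theorem eq_zero_of_forall_mul_eq_zero {A B : Type*} [NonUnitalCStarAlgebra A] [PartialOrder A]
    [StarOrderedRing A] [TopologicalSpace B] [T2Space B] [Zero B] {f : A → B}
    (hf : Continuous f) (x : A) (h : ∀ e, f (e * x) = 0) : f x = 0 := by
  have hu := (CStarAlgebra.increasingApproximateUnit A).toIsApproximateUnit
  have := hu.neBot
  exact tendsto_nhds_unique ((hf.tendsto x).comp (hu.tendsto_mul_right x))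
    (tendsto_const_nhds.congr fun e => (h e).symm)

section MulEqZero

variable {A B : Type*} [NonUnitalCStarAlgebra A] [PartialOrder A] [StarOrderedRing A]
  [NonUnitalCStarAlgebra B] [PartialOrder B] [StarOrderedRing B]

theorem mul_eq_zero_of_star_mul_mul_eq_zero {a v : A} (ha : 0 ≤ a) (h : star v * a * v = 0) :
    a * v = 0 := by
  obtain ⟨s, hs⟩ := CStarAlgebra.nonneg_iff_eq_star_mul_self.mp ha
  have hv : s * v = 0 := by
    rw [← CStarRing.star_mul_self_eq_zero_iff, star_mul, ← h, hs]
    simp only [mul_assoc]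
  rw [hs, mul_assoc, hv, mul_zero]

/-- If `!![a, b; b', c]` is a positive `2 × 2` matrix, then right zero divisors of `c` are
right zero divisors of `b`. -/
theorem CStarMatrix.mul_eq_zero_of_nonneg {M : CStarMatrix (Fin 2) (Fin 2) A} (hM : 0 ≤ M) {y : A}
    (hy : M 1 1 * y = 0) : M 0 1 * y = 0 := by
  let V : CStarMatrix (Fin 2) (Fin 2) A := CStarMatrix.ofMatrix !![0, 0; 0, y]
  have hV : star V * M * V = 0 := by
    rw [mul_assoc]
    ext i j
    fin_cases i <;> fin_cases j <;>
      simp [V, CStarMatrix.mul_apply, CStarMatrix.star_apply, hy]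
  have := CStarMatrix.ext_iff.mpr (mul_eq_zero_of_star_mul_mul_eq_zero hM hV) 0 1
  simpa [V, CStarMatrix.mul_apply] using! this

theorem map_mul_mul_eq_zero_of_map_star_mul_self (θ : A →CP B) (x : A) {y : B}
    (h : θ (star x * x) * y = 0) : θ x * y = 0 := by
  refine eq_zero_of_forall_mul_eq_zero (f := fun x => θ x * y) (by fun_prop) x fun e => ?_
  -- Without a unit, `e` replaces the 1 in `!![1, x; star x, star x * x]`; an approximate unit
  -- removes it.
  let R : CStarMatrix (Fin 2) (Fin 2) A := CStarMatrix.ofMatrix !![star e, x; 0, 0]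
  have hR := θ.map_cstarMatrix_nonneg _ (star_mul_self_nonneg R)
  have h11 : (star R * R) 1 1 = star x * x := by
    simp [R, CStarMatrix.mul_apply, CStarMatrix.star_apply]
  have h01 : (star R * R) 0 1 = e * x := by
    simp [R, CStarMatrix.mul_apply, CStarMatrix.star_apply]
  have := CStarMatrix.mul_eq_zero_of_nonneg hR (y := y) (by
    rw [CStarMatrix.map_apply, h11, h])
  rwa [CStarMatrix.map_apply, h01] at this

/-- Completely positive order zero maps preserve all zero products. -/
theorem IsOrderZero.map_mul_map_eq_zero {θ : A →CP B} (hθ : IsOrderZero θ) {x y : A}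
    (h : x * y = 0) : θ x * θ y = 0 := by
  have h1 : θ x * θ (y * star y) = 0 := by
    refine map_mul_mul_eq_zero_of_map_star_mul_self θ x
      (hθ _ _ (star_mul_self_nonneg x) (mul_star_self_nonneg y) ?_)
    rw [mul_assoc, ← mul_assoc x, h, zero_mul, mul_zero]
  have h2 : θ (star y) * θ (star x) = 0 := by
    refine map_mul_mul_eq_zero_of_map_star_mul_self θ (star y) ?_
    rw [star_star, ← star_eq_zero, star_mul, ← map_star, ← map_star, star_star, star_mul,
      star_star, h1]
  rw [← star_eq_zero, star_mul, ← map_star, ← map_star, h2]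

end MulEqZero

/-! ### The balanced identity -/

section Balanced

variable {A B : Type*} [NonUnitalCStarAlgebra A] [NonUnitalCStarAlgebra B]

theorem Unitization.inr_snd_inr_mul (x : A) (F : Unitization ℂ A) :
    (((x : Unitization ℂ A) * F).snd : Unitization ℂ A) = x * F := by
  ext <;> simp

theorem Unitization.inr_snd_mul_inr (x : A) (F : Unitization ℂ A) :
    ((F * (x : Unitization ℂ A)).snd : Unitization ℂ A) = F * x := by
  ext <;> simp

variable [PartialOrder A] [StarOrderedRing A]

/-- Apply `bilinear_apply_one_eq` to `(f, g) ↦ θ(x f(y)) θ(g(y) z)` at the identity function. The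
unitization gives meaning to `f(y)` when `f` does not vanish at zero; the products with `x` and `z`
fall back into `A`. -/
theorem map_mul_map_eq_of_nonneg (θ : A →L[ℂ] B) (h : ∀ x y, x * y = 0 → θ x * θ y = 0)
    (x z : A) {y : A} (hy : 0 ≤ y) : θ (x * y) * θ z = θ x * θ (y * z) := by
  have hY0 : 0 ≤ (y : Unitization ℂ A) := by simpa using hy
  have hY : IsSelfAdjoint (y : Unitization ℂ A) := .of_nonneg hY0
  let Φ := cfcHom (R := ℝ) hY
  let L : C(spectrum ℝ (y : Unitization ℂ A), ℝ) →ₗ[ℝ] B :=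
    { toFun := fun f => θ ((x : Unitization ℂ A) * Φ f).snd
      map_add' := fun f g => by simp [mul_add]
      map_smul' := fun c f => by simp }
  let R : C(spectrum ℝ (y : Unitization ℂ A), ℝ) →ₗ[ℝ] B :=
    { toFun := fun f => θ (Φ f * (z : Unitization ℂ A)).snd
      map_add' := fun f g => by simp [add_mul]
      map_smul' := fun c f => by simp }
  have hΦ : ∀ f, ‖Φ f‖ = ‖f‖ := fun f => norm_cfcHom _ f
  have hL : ∀ f, ‖L f‖ ≤ ‖θ‖ * ‖x‖ * ‖f‖ := fun f => by
    refine (θ.le_opNorm _).trans ?_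
    rw [mul_assoc, ← Unitization.norm_inr (𝕜 := ℂ) (_ : A), Unitization.inr_snd_inr_mul]
    gcongr
    refine (norm_mul_le _ _).trans ?_
    rw [hΦ, Unitization.norm_inr]
  have hR : ∀ f, ‖R f‖ ≤ ‖θ‖ * ‖z‖ * ‖f‖ := fun f => by
    refine (θ.le_opNorm _).trans ?_
    rw [mul_assoc, ← Unitization.norm_inr (𝕜 := ℂ) (_ : A), Unitization.inr_snd_mul_inr]
    gcongr
    refine (norm_mul_le _ _).trans ?_
    rw [hΦ, Unitization.norm_inr, mul_comm]
  have key := bilinear_apply_one_eq ((LinearMap.mul ℝ B).compl₁₂ L R)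
    (C := ‖θ‖ * ‖x‖ * (‖θ‖ * ‖z‖)) (by positivity) (fun f g => ?_) (fun f g hfg => ?_)
    (f := (ContinuousMap.id ℝ).restrict _) (fun t => spectrum_nonneg_of_nonneg hY0 t.2)
  · have hid : Φ ((ContinuousMap.id ℝ).restrict _) = y := cfcHom_id _
    simpa [L, R, hid, ← Unitization.inr_mul] using key
  · simp only [LinearMap.compl₁₂_apply, LinearMap.mul_apply']
    calc ‖L f * R g‖ ≤ ‖L f‖ * ‖R g‖ := norm_mul_le _ _
      _ ≤ (‖θ‖ * ‖x‖ * ‖f‖) * (‖θ‖ * ‖z‖ * ‖g‖) := by gcongr; exacts [hL f, hR g]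
      _ = _ := by ring
  · refine h _ _ (Unitization.inr_injective (R := ℂ) ?_)
    rw [Unitization.inr_mul, Unitization.inr_snd_inr_mul, Unitization.inr_snd_mul_inr, mul_assoc,
      ← mul_assoc (Φ f), ← map_mul, hfg, map_zero, zero_mul, mul_zero, Unitization.inr_zero]

/-- A bounded linear map on a C⋆-algebra that preserves zero products is balanced:
`θ(xy) θ(z) = θ(x) θ(yz)`. -/
theorem map_mul_map_eq (θ : A →L[ℂ] B) (h : ∀ x y, x * y = 0 → θ x * θ y = 0)
    (x y z : A) : θ (x * y) * θ z = θ x * θ (y * z) := by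
  have hy : y ∈ Submodule.span ℂ {a : A | 0 ≤ a} := by
    rw [CStarAlgebra.span_nonneg]; trivial
  induction hy using Submodule.span_induction with
  | mem y hy => exact map_mul_map_eq_of_nonneg θ h x z hy
  | zero => simp
  | add a b _ _ ha hb => simp only [mul_add, add_mul, map_add, ha, hb]
  | smul c a _ ha => simp only [mul_smul_comm, smul_mul_assoc, map_smul, ha]

end Balanced

theorem IsOrderZero.map_mul_map_eq {A B : Type*} [NonUnitalCStarAlgebra A] [PartialOrder A]
    [StarOrderedRing A] [NonUnitalCStarAlgebra B] [PartialOrder B] [StarOrderedRing B]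
    {θ : A →CP B} (hθ : IsOrderZero θ) (x y z : A) : θ (x * y) * θ z = θ x * θ (y * z) :=
  _root_.map_mul_map_eq ⟨θ.toLinearMap, map_continuous θ⟩ (fun _ _ => hθ.map_mul_map_eq_zero) x y z

/-! ### Iterated products and spectral pieces in non-unital algebras -/

section CStar

variable {A : Type*} [NonUnitalCStarAlgebra A]

theorem norm_iterate_mul_left_le (a z : A) (n : ℕ) : ‖(a * ·)^[n] z‖ ≤ ‖a‖ ^ n * ‖z‖ := by
  induction n with
  | zero => simp
  | succ n ih =>
    rw [Function.iterate_succ_apply', pow_succ', mul_assoc]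
    exact (norm_mul_le _ _).trans (by gcongr)

theorem norm_iterate_mul_right_le (a z : A) (n : ℕ) : ‖(· * a)^[n] z‖ ≤ ‖a‖ ^ n * ‖z‖ := by
  induction n with
  | zero => simp
  | succ n ih =>
    rw [Function.iterate_succ_apply', pow_succ, mul_right_comm]
    exact (norm_mul_le _ _).trans (by gcongr)

theorem iterate_mul_left_mul (a z w : A) (n : ℕ) :
    (a * ·)^[n] z * w = (a * ·)^[n] (z * w) := by
  induction n with
  | zero => rfl
  | succ n ih => rw [Function.iterate_succ_apply', Function.iterate_succ_apply', mul_assoc, ih]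

theorem IsSelfAdjoint.norm_iterate_mul_self {a : A} (ha : IsSelfAdjoint a) {n k : ℕ}
    (hn : n + 2 = 2 ^ k) : ‖(a * ·)^[n] (a * a)‖ = ‖a‖ ^ (n + 2) := by
  have key : ∀ n : ℕ, (((a * ·)^[n] (a * a) : A) : Unitization ℂ A) =
      (a : Unitization ℂ A) ^ (n + 2) := by
    intro n
    induction n with
    | zero => simp [sq]
    | succ n ih => rw [Function.iterate_succ_apply', Unitization.inr_mul, ih, ← pow_succ']
  rw [← Unitization.norm_inr (𝕜 := ℂ), key, hn,
    IsSelfAdjoint.norm_pow_two_pow (by simpa using ha.inr ℂ), Unitization.norm_inr]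

theorem iterate_mul_right_iterate_mul_right {x y q : A} (hqx : q * x = x * q)
    (hy : y * q * x = y) (n : ℕ) : (· * x)^[n] ((· * q)^[n] y) = y := by
  have key : ∀ n, (· * q)^[n] y * q * x = (· * q)^[n] y := by
    intro n
    induction n with
    | zero => exact hy
    | succ n ih =>
      rw [Function.iterate_succ_apply', mul_assoc _ q x, hqx, ← mul_assoc, ih]
  induction n with
  | zero => rfl
  | succ n ih =>
    rw [Function.iterate_succ_apply, Function.iterate_succ_apply', key, ih]

variable [PartialOrder A] [StarOrderedRing A]

/-- Below the norm of a positive element there is a spectral piece on which the element is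
invertible with a small inverse. -/
theorem exists_mul_mul_eq_self_of_lt_norm {x : A} (hx : 0 ≤ x) {s : ℝ} (hs : 0 ≤ s)
    (hsx : s < ‖x‖) : ∃ y q : A, y ≠ 0 ∧ q * x = x * q ∧ y * q * x = y ∧ s * ‖q‖ < 1 := by
  obtain ⟨m, hsm, hmx⟩ := exists_between hsx
  have hm : 0 < m := hs.trans_lt hsm
  have hxs : IsSelfAdjoint x := .of_nonneg hx
  have hid : cfcₙ (fun t : ℝ => t) x = x := cfcₙ_id' ℝ x
  -- `f` lives above `m`, where `g` is `1 / t`; `g` vanishes at 0 and is at most `1 / m` on `t ≥ 0`.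
  let f : ℝ → ℝ := fun t => max (t - m) 0
  let g : ℝ → ℝ := fun t => t / (max t m) ^ 2
  have hpos : ∀ t : ℝ, max t m ≠ 0 := fun t => (hm.trans_le (le_max_right _ _)).ne'
  have hf : Continuous f := by fun_prop
  have hg : Continuous g := continuous_id.div (by fun_prop) fun t => pow_ne_zero 2 (hpos t)
  have hf0 : f 0 = 0 := by simp [f, hm.le]
  have hg0 : g 0 = 0 := by simp [g]
  refine ⟨cfcₙ f x, cfcₙ g x, ?_, ?_, ?_, ?_⟩
  · intro h
    have e : cfcₙ (fun t => min t m) x = x := by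
      rw [← add_zero (cfcₙ (fun t => min t m) x), ← h,
        ← cfcₙ_add (fun t => min t m) f x (by fun_prop) (by simp [hm.le]) (by fun_prop) hf0]
      conv_rhs => rw [← hid]
      congr 1
      ext t
      simp only [f]
      rcases le_total t m with ht | ht
      · rw [min_eq_left ht, max_eq_right (by linarith), add_zero]
      · rw [min_eq_right ht, max_eq_left (by linarith)]; ring
    refine hmx.not_ge ?_
    rw [← e]
    refine norm_cfcₙ_le fun t ht => ?_
    have ht0 : 0 ≤ t := quasispectrum_nonneg_of_nonneg x hx t ht
    rw [Real.norm_of_nonneg (le_min ht0 hm.le)]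
    exact min_le_right _ _
  · nth_rewrite 2 [← hid]
    nth_rewrite 3 [← hid]
    rw [← cfcₙ_mul g (fun t => t) x, ← cfcₙ_mul (fun t => t) g x]
    simp only [mul_comm]
  · nth_rewrite 3 [← hid]
    rw [← cfcₙ_mul f g x, ← cfcₙ_mul (fun t => f t * g t) (fun t => t) x (by fun_prop)
      (by simp [hf0])]
    congr 1
    ext t
    simp only [f, g]
    rcases le_total t m with ht | ht
    · rw [max_eq_right (by linarith : t - m ≤ 0)]; ring
    · have : t ≠ 0 := (hm.trans_le ht).ne'
      rw [max_eq_left ht]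
      field_simp
  · have : ‖cfcₙ g x‖ ≤ m⁻¹ := by
      refine norm_cfcₙ_le fun t ht => ?_
      have ht0 : 0 ≤ t := quasispectrum_nonneg_of_nonneg x hx t ht
      have h1 : t ≤ max t m := le_max_left _ _
      have h2 : m ≤ max t m := le_max_right _ _
      rw [Real.norm_of_nonneg (by positivity), div_le_iff₀ (by positivity), inv_mul_eq_div,
        le_div_iff₀ hm, sq]
      gcongr
    calc s * ‖cfcₙ g x‖ ≤ s * m⁻¹ := by gcongr
      _ < 1 := by rwa [← div_eq_mul_inv, div_lt_one hm]

theorem IsSelfAdjoint.exists_star_mul_self_sub {x : A} (hx : IsSelfAdjoint x) :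
    ∃ s m : A, 0 ≤ m ∧ s * m = 0 ∧ star s * s - m = x := by
  obtain ⟨s, hs⟩ := CStarAlgebra.nonneg_iff_eq_star_mul_self.mp (CFC.posPart_nonneg x)
  refine ⟨s, x⁻, CFC.negPart_nonneg x, ?_, hs ▸ CFC.posPart_sub_negPart x hx⟩
  rw [← CStarRing.star_mul_self_eq_zero_iff, star_mul, mul_assoc, ← mul_assoc (star s), ← hs,
    CFC.posPart_mul_negPart, mul_zero]

/-- Compressing `p - n` by `n` leaves `-n³`, which is then both nonnegative and nonpositive. -/
theorem eq_zero_of_nonneg_sub_of_mul_eq_zero {p n : A} (hn : 0 ≤ n) (h : p * n = 0)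
    (hpn : 0 ≤ p - n) : n = 0 := by
  have h1 : 0 ≤ n * (p - n) * n := conjugate_nonneg_of_nonneg hpn hn
  rw [mul_assoc, sub_mul, h, zero_sub, mul_neg, ← mul_assoc, Left.nonneg_neg_iff] at h1
  have h2 : star n * n * n = 0 := by
    rw [(IsSelfAdjoint.of_nonneg hn).star_eq]
    exact le_antisymm h1 (conjugate_nonneg_of_nonneg hn hn)
  have h3 := mul_eq_zero_of_star_mul_mul_eq_zero hn h2
  rw [← CStarRing.star_mul_self_eq_zero_iff, (IsSelfAdjoint.of_nonneg hn).star_eq, h3]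

end CStar

/-! ### Consequences of balancedness and the power trick -/

section Balanced

variable {A B : Type*} [NonUnitalCStarAlgebra A] [NonUnitalCStarAlgebra B] {Θ : A → B}

theorem iterate_mul_map_iterate (hΘ : ∀ x y z, Θ (x * y) * Θ z = Θ x * Θ (y * z)) (d x w : A)
    (n : ℕ) : (Θ d * ·)^[n] (Θ ((· * x)^[n] w)) = (· * Θ x)^[n] (Θ ((d * ·)^[n] w)) := by
  have comm : ∀ (n : ℕ) (u : A), d * (· * x)^[n] u = (· * x)^[n] (d * u) := by
    intro n u
    induction n with
    | zero => rfl
    | succ n ih => rw [Function.iterate_succ_apply', Function.iterate_succ_apply', ← ih, mul_assoc]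
  induction n generalizing w with
  | zero => rfl
  | succ n ih =>
    rw [Function.iterate_succ_apply, Function.iterate_succ_apply', ← hΘ, comm,
      ← iterate_mul_left_mul, ih, Function.iterate_succ_apply' (· * Θ x),
      Function.iterate_succ_apply (d * ·)]

/-- Iterating the C⋆-identity gives `‖Θ x‖ ^ 2 ^ k ≤ K * ‖x‖ ^ 2 ^ k`, so `K` is lost in the limit.
-/
theorem norm_map_le_of_mul {K : ℝ} (hK : ∀ x, ‖Θ x‖ ≤ K * ‖x‖)
    (hstar : ∀ x, Θ (star x) = star (Θ x)) (hmul : ∀ x y, ‖Θ x * Θ y‖ ≤ ‖Θ (x * y)‖) (x : A) :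
    ‖Θ x‖ ≤ ‖x‖ := by
  have key : ∀ (k : ℕ) (x : A), ‖Θ x‖ ^ 2 ^ k ≤ K * ‖x‖ ^ 2 ^ k := by
    intro k
    induction k with
    | zero => simpa using hK
    | succ k ih =>
      intro x
      calc ‖Θ x‖ ^ 2 ^ (k + 1) = (‖Θ x * Θ (star x)‖) ^ 2 ^ k := by
            rw [hstar, CStarRing.norm_self_mul_star, pow_succ', pow_mul, sq]
        _ ≤ ‖Θ (x * star x)‖ ^ 2 ^ k := by gcongr; exact hmul _ _
        _ ≤ K * ‖x * star x‖ ^ 2 ^ k := ih _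
        _ = K * ‖x‖ ^ 2 ^ (k + 1) := by
            rw [CStarRing.norm_self_mul_star, pow_succ' 2 k, pow_mul, sq]
  by_contra! hlt
  rcases (norm_nonneg x).eq_or_lt with h0 | h0
  · have := hK x
    rw [← h0, mul_zero] at this
    linarith
  · have hr : 1 < ‖Θ x‖ / ‖x‖ := by rwa [one_lt_div h0]
    obtain ⟨n, hn⟩ := pow_unbounded_of_one_lt K hr
    have h1 : (‖Θ x‖ / ‖x‖) ^ n ≤ (‖Θ x‖ / ‖x‖) ^ 2 ^ n :=
      pow_le_pow_right₀ hr.le Nat.lt_two_pow_self.le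
    rw [div_pow _ _ (2 ^ n)] at h1
    have h2 := hn.trans_le h1
    rw [lt_div_iff₀ (by positivity)] at h2
    exact h2.not_ge (key n x)

end Balanced

/-! ### Constant diagonal matrices -/

namespace CStarMatrix

variable {n A B : Type*} [Fintype n]

theorem norm_le_sum_norm [NonUnitalCStarAlgebra A] [PartialOrder A] [StarOrderedRing A]
    (M : CStarMatrix n n A) : ‖M‖ ≤ ∑ j, ∑ i, ‖M i j‖ := by
  rw [norm_def]
  refine (toCLM M).opNorm_le_bound (by positivity) fun v => ?_
  simp only [toCLM_apply_eq_sum, Finset.sum_mul]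
  refine (WithCStarModule.pi_norm_le_sum_norm _).trans ?_
  gcongr with i _
  refine (norm_sum_le _ _).trans ?_
  gcongr with j _
  refine (norm_mul_le _ _).trans ?_
  rw [mul_comm]
  gcongr
  exact WithCStarModule.norm_apply_le_norm v j

variable [DecidableEq n]

/-- The embedding of `A` into matrices over `A` as constant diagonal matrices. -/
def diagonalHom (n A : Type*) [Fintype n] [DecidableEq n] [NonUnitalCStarAlgebra A] :
    A →⋆ₙₐ[ℂ] CStarMatrix n n A where
  toFun a := ofMatrix (Matrix.diagonal fun _ => a)
  map_smul' c a := by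
    ext i j
    by_cases h : i = j <;> simp [h]
  map_zero' := by
    ext i j
    by_cases h : i = j <;> simp [h]
  map_add' a b := by
    ext i j
    by_cases h : i = j <;> simp [h]
  map_mul' a b := by
    ext i j
    by_cases h : i = j <;> simp [Matrix.diagonal_apply, mul_apply, h]
  map_star' a := by
    ext i j
    by_cases h : i = j
    · simp [star_apply, h]
    · simp [star_apply, h, Ne.symm h]

theorem diagonalHom_mul_apply [NonUnitalCStarAlgebra A] (a : A) (M : CStarMatrix n n A) (i j : n) :
    (diagonalHom n A a * M) i j = a * M i j :=
  Matrix.diagonal_mul _ _ _ _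

theorem diagonalHom_map [NonUnitalCStarAlgebra A] [NonUnitalCStarAlgebra B] {f : A → B}
    (hf : f 0 = 0) (a : A) : (diagonalHom n A a).map f = diagonalHom n B (f a) :=
  Matrix.diagonal_map hf

theorem norm_diagonalHom_le [NonUnitalCStarAlgebra A] [PartialOrder A] [StarOrderedRing A] (a : A) :
    ‖diagonalHom n A a‖ ≤ ‖a‖ :=
  NonUnitalStarAlgHom.norm_apply_le _ a

theorem norm_diagonalHom [Nonempty n] [NonUnitalCStarAlgebra A] [PartialOrder A]
    [StarOrderedRing A] (a : A) : ‖diagonalHom n A a‖ = ‖a‖ := by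
  obtain ⟨i⟩ := ‹Nonempty n›
  refine le_antisymm (norm_diagonalHom_le a) ?_
  have h : diagonalHom n A a i i = a := Matrix.diagonal_apply_eq _ i
  nth_rewrite 1 [← h]
  exact norm_entry_le_norm

open Filter Topology in
theorem tendsto_diagonalHom_mul [NonUnitalCStarAlgebra A] [PartialOrder A] [StarOrderedRing A]
    (M : CStarMatrix n n A) :
    Tendsto (fun e => diagonalHom n A e * M) (CStarAlgebra.approximateUnit A) (𝓝 M) := by
  refine tendsto_pi_nhds.mpr fun i => tendsto_pi_nhds.mpr fun j => ?_
  simp only [diagonalHom_mul_apply]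
  exact (CStarAlgebra.increasingApproximateUnit A).tendsto_mul_right _

end CStarMatrix

/-! ### Order and norm of the amplifications -/

section Amplification

variable {A B : Type*} [NonUnitalCStarAlgebra A] [PartialOrder A] [StarOrderedRing A]
  [NonUnitalCStarAlgebra B] [PartialOrder B] [StarOrderedRing B] {n : Type*}
  {θ : A →CP B}

theorem CompletelyPositiveMap.map_star_amplification (θ : A →CP B) (x : CStarMatrix n n A) :
    (star x).map θ = star (x.map θ) := by
  ext i j
  simp [CStarMatrix.star_apply, map_star]

theorem CompletelyPositiveMap.map_sub_amplification (θ : A →CP B) (x y : CStarMatrix n n A) :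
    (x - y).map θ = x.map θ - y.map θ := by
  ext i j
  simp

theorem continuous_amplification (θ : A →CP B) :
    Continuous fun x : CStarMatrix n n A => x.map θ :=
  continuous_pi fun i => continuous_pi fun j =>
    (map_continuous θ).comp ((continuous_apply j).comp (continuous_apply i))

variable [Fintype n]

theorem IsOrderZero.amplification_balanced (hθ : IsOrderZero θ) (x y z : CStarMatrix n n A) :
    (x * y).map θ * z.map θ = x.map θ * (y * z).map θ := by
  ext i j
  simp only [CStarMatrix.mul_apply, CStarMatrix.map_apply, map_sum, Finset.sum_mul,
    Finset.mul_sum, hθ.map_mul_map_eq]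
  exact Finset.sum_comm

theorem IsOrderZero.nonneg_of_amplification_nonneg (hθ : IsOrderZero θ)
    (hinj : Function.Injective θ) {x : CStarMatrix n n A} (hx : 0 ≤ x.map θ) : 0 ≤ x := by
  have hinj' : Function.Injective fun x : CStarMatrix n n A => x.map θ :=
    CStarMatrix.map_injective hinj
  have hxs : IsSelfAdjoint x := hinj' (by
    simp only [θ.map_star_amplification, (IsSelfAdjoint.of_nonneg hx).star_eq])
  obtain ⟨s, m, hm, hs0, rfl⟩ := hxs.exists_star_mul_self_sub
  have hzero : (0 : CStarMatrix n n A).map θ = 0 := CStarMatrix.ext fun _ _ => map_zero θ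
  have hmul : (star s * s).map θ * m.map θ = 0 := by
    rw [hθ.amplification_balanced, hs0, hzero, mul_zero]
  have hm0 : m = 0 := hinj' <| by
    simp only [hzero]
    refine eq_zero_of_nonneg_sub_of_mul_eq_zero (θ.map_cstarMatrix_nonneg _ hm) hmul ?_
    rwa [← θ.map_sub_amplification]
  rw [hm0, sub_zero]
  exact star_mul_self_nonneg s

variable [DecidableEq n]

-- Along an approximate unit, `θ(ex) θ(y) = θ(e) θ(xy)` with `‖θ(e)‖ ≤ 1`.
open Filter Topology in
theorem IsOrderZero.norm_amplification_mul_le (hθ : IsOrderZero θ) (hn : ∀ a, ‖θ a‖ ≤ ‖a‖)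
    (x y : CStarMatrix n n A) : ‖x.map θ * y.map θ‖ ≤ ‖(x * y).map θ‖ := by
  have hu := CStarAlgebra.increasingApproximateUnit A
  have ht : Tendsto (fun e => (CStarMatrix.diagonalHom n A e * x).map θ * y.map θ)
      (CStarAlgebra.approximateUnit A) (𝓝 (x.map θ * y.map θ)) :=
    (((continuous_amplification θ).tendsto x).comp
      (CStarMatrix.tendsto_diagonalHom_mul x)).mul_const _
  refine le_of_tendsto ht.norm ?_
  filter_upwards [hu.eventually_norm] with e he
  rw [hθ.amplification_balanced, CStarMatrix.diagonalHom_map (map_zero θ)]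
  calc _ ≤ ‖CStarMatrix.diagonalHom n B (θ e)‖ * ‖(x * y).map θ‖ := norm_mul_le _ _
    _ ≤ 1 * ‖(x * y).map θ‖ := by
      gcongr
      exact (CStarMatrix.norm_diagonalHom_le _).trans ((hn e).trans he)
    _ = _ := one_mul _

theorem IsOrderZero.norm_amplification_le (hθ : IsOrderZero θ) (hn : ∀ a, ‖θ a‖ ≤ ‖a‖)
    (x : CStarMatrix n n A) : ‖x.map θ‖ ≤ ‖x‖ := by
  refine norm_map_le_of_mul (Θ := fun x : CStarMatrix n n A => x.map θ)
    (K := Fintype.card n * Fintype.card n) (fun x => ?_) (θ.map_star_amplification)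
    (hθ.norm_amplification_mul_le hn) x
  calc ‖x.map θ‖ ≤ ∑ j, ∑ i, ‖x.map θ i j‖ := CStarMatrix.norm_le_sum_norm _
    _ ≤ ∑ _j : n, ∑ _i : n, ‖x‖ := by
      gcongr with j _ i _
      exact (hn _).trans CStarMatrix.norm_entry_le_norm
    _ = _ := by simp [mul_assoc]

theorem IsOrderZero.le_norm_amplification_of_nonneg (hθ : IsOrderZero θ) (hn : ∀ a, ‖θ a‖ = ‖a‖)
    {x : CStarMatrix n n A} (hx : 0 ≤ x) : ‖x‖ ≤ ‖x.map θ‖ := by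
  by_contra! hlt
  obtain ⟨y, q, hy, hqx, hyqx, hq⟩ := exists_mul_mul_eq_self_of_lt_norm hx (norm_nonneg _) hlt
  obtain ⟨i, j, hc⟩ : ∃ i j, y i j ≠ 0 := by
    by_contra! h
    exact hy (CStarMatrix.ext h)
  set c := y i j
  set b := c * star c
  have hb : 0 < ‖b‖ := by
    rw [norm_pos_iff]
    exact CStarRing.mul_star_self_ne_zero_iff c |>.mpr hc
  have hbs : IsSelfAdjoint (θ b) := by
    rw [IsSelfAdjoint, ← map_star, (IsSelfAdjoint.mul_star_self c).star_eq]
  -- Write `y = y qᵏ xᵏ` and move the powers: with `D` the diagonal of `b`, `θ(D)ᵏ θ(y) = θ(Dᵏ y qᵏ)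
  -- θ(x)ᵏ`. Then read off the entry `(i, j)`.
  have upper : ∀ k, ‖(θ b * ·)^[k] (θ c)‖ ≤ (‖x.map θ‖ * ‖q‖) ^ k * ‖b‖ ^ k * ‖y‖ := by
    intro k
    have e := iterate_mul_map_iterate (Θ := fun x : CStarMatrix n n A => x.map θ)
      hθ.amplification_balanced (CStarMatrix.diagonalHom n A b) x ((· * q)^[k] y) k
    rw [iterate_mul_right_iterate_mul_right hqx hyqx, CStarMatrix.diagonalHom_map (map_zero θ)] at e
    have entry : ∀ (k : ℕ) (z : CStarMatrix n n B),
        ((CStarMatrix.diagonalHom n B (θ b) * ·)^[k] z) i j = (θ b * ·)^[k] (z i j) := by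
      intro k z
      induction k with
      | zero => rfl
      | succ k ih =>
        rw [Function.iterate_succ_apply', Function.iterate_succ_apply',
          CStarMatrix.diagonalHom_mul_apply, ih]
    rw [show θ c = y.map θ i j from rfl, ← entry, e]
    calc _ ≤ _ := CStarMatrix.norm_entry_le_norm
      _ ≤ _ := norm_iterate_mul_right_le _ _ _
      _ ≤ ‖x.map θ‖ ^ k * (‖b‖ ^ k * (‖q‖ ^ k * ‖y‖)) := by
        gcongr
        refine (hθ.norm_amplification_le (fun a => (hn a).le) _).trans
          ((norm_iterate_mul_left_le _ _ _).trans ?_)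
        gcongr
        · exact CStarMatrix.norm_diagonalHom_le b
        · exact norm_iterate_mul_right_le _ _ _
      _ = _ := by ring
  -- As `θ(c) θ(c⋆b) = θ(b)²`, the iterate times `θ(c⋆b)` has norm `‖b‖ ^ (m + 2)`, with `m + 2` a
  -- power of two for the C⋆-identity.
  have lower : ∀ k, ‖b‖ ^ 2 ≤
      (‖x.map θ‖ * ‖q‖) ^ (2 ^ (k + 1) - 2) * (‖y‖ * ‖θ (star c * b)‖) := by
    intro k
    have hk : 2 ^ (k + 1) - 2 + 2 = 2 ^ (k + 1) :=
      Nat.sub_add_cancel (by rw [pow_succ]; linarith [Nat.one_le_two_pow (n := k)])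
    set m := 2 ^ (k + 1) - 2
    have e : (θ b * ·)^[m] (θ c) * θ (star c * b) = (θ b * ·)^[m] (θ b * θ b) := by
      rw [iterate_mul_left_mul, ← hθ.map_mul_map_eq]
    have h1 : ‖b‖ ^ (m + 2) ≤ ((‖x.map θ‖ * ‖q‖) ^ m * ‖b‖ ^ m * ‖y‖) * ‖θ (star c * b)‖ := by
      rw [← hn b, ← hbs.norm_iterate_mul_self hk, ← e, hn b]
      exact (norm_mul_le _ _).trans (by gcongr; exact upper m)
    refine le_of_mul_le_mul_left ?_ (pow_pos hb m)
    rw [← pow_add]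
    linarith
  have hlim : Filter.Tendsto (fun k : ℕ => (‖x.map θ‖ * ‖q‖) ^ (2 ^ (k + 1) - 2) *
      (‖y‖ * ‖θ (star c * b)‖)) Filter.atTop (nhds 0) := by
    rw [← zero_mul (‖y‖ * ‖θ (star c * b)‖)]
    refine ((tendsto_pow_atTop_nhds_zero_of_lt_one (by positivity) hq).comp ?_).mul_const _
    refine Filter.tendsto_atTop_mono (fun k => ?_) Filter.tendsto_id
    have := Nat.lt_two_pow_self (n := k)
    simp only [id, pow_succ]
    omega
  have := ge_of_tendsto' hlim lower
  have : 0 < ‖b‖ ^ 2 := by positivity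
  linarith

theorem IsOrderZero.norm_amplification (hθ : IsOrderZero θ) (hn : ∀ a, ‖θ a‖ = ‖a‖)
    (x : CStarMatrix n n A) : ‖x.map θ‖ = ‖x‖ := by
  have hle : ∀ z : CStarMatrix n n A, ‖z.map θ‖ ≤ ‖z‖ :=
    hθ.norm_amplification_le fun a => (hn a).le
  refine le_antisymm (hle x) ?_
  rcases (norm_nonneg x).eq_or_lt with h0 | h0
  · rw [← h0]; exact norm_nonneg _
  have h1 := hθ.le_norm_amplification_of_nonneg hn (mul_star_self_nonneg x)
  -- Balancing turns `θ(xx⋆)²` into `θ(x) θ(x⋆xx⋆)`, which isolates one factor `‖θ(x)‖`.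
  have h2 : ‖(x * star x).map θ‖ * ‖(x * star x).map θ‖ ≤
      ‖x.map θ‖ * (‖x‖ * (‖x‖ * ‖x‖)) := by
    rw [← CStarRing.norm_self_mul_star (x := (x * star x).map θ), ← θ.map_star_amplification,
      star_mul, star_star, hθ.amplification_balanced]
    refine (norm_mul_le _ _).trans ?_
    gcongr
    refine (hle _).trans ((norm_mul_le _ _).trans ?_)
    rw [norm_star]
    gcongr
    rw [CStarRing.norm_self_mul_star]
  rw [CStarRing.norm_self_mul_star] at h1
  have h3 : ‖x‖ * ‖x‖ * (‖x‖ * ‖x‖) ≤ ‖x.map θ‖ * (‖x‖ * (‖x‖ * ‖x‖)) :=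
    (mul_le_mul h1 h1 (by positivity) (by positivity)).trans h2
  refine le_of_mul_le_mul_right ?_ (show 0 < ‖x‖ * (‖x‖ * ‖x‖) by positivity)
  linarith

end Amplification

theorem mainTheorem7 {A B : Type*}
    [NonUnitalCStarAlgebra A] [PartialOrder A] [StarOrderedRing A]
    [NonUnitalCStarAlgebra B] [PartialOrder B] [StarOrderedRing B]
    (θ : A →CP B) (hθ : IsOrderZero θ) :
    Isometry θ ↔ IsCompleteOrderEmbedding θ := by
  constructor
  · intro h
    have hn : ∀ a, ‖θ a‖ = ‖a‖ := (AddMonoidHomClass.isometry_iff_norm θ).mp h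
    refine ⟨fun r _ => Isometry.of_dist_eq fun x y => ?_, fun r _ x =>
      ⟨θ.map_cstarMatrix_nonneg x, hθ.nonneg_of_amplification_nonneg h.injective⟩⟩
    rw [dist_eq_norm, dist_eq_norm, ← θ.map_sub_amplification, hθ.norm_amplification hn]
  · intro h
    refine (AddMonoidHomClass.isometry_iff_norm θ).mpr fun a => ?_
    have h0 : (0 : CStarMatrix (Fin 1) (Fin 1) A).map θ = 0 := by
      ext i j
      simp
    have h1 := (h.isometry_map 1 le_rfl).norm_map_of_map_zero h0 (CStarMatrix.diagonalHom _ A a)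
    rwa [CStarMatrix.diagonalHom_map (map_zero θ), CStarMatrix.norm_diagonalHom,
      CStarMatrix.norm_diagonalHom] at h1
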